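/- Let $A\in\mathbb{R}^{p\times n}$, $B\in\mathbb{R}^{p\times m}$, $b\in\mathbb{R}^p$ and $c\in\mathbb{R}^m$, let $\mathbb{R}^n,\mathbb{R}^m$ carry the Euclidean norms, and assume that $$D:=\{(x,y)\in\mathbb{R}^n\times\mathbb{R}^m : Ax+By\le b\}$$ (componentwise inequality) is nonempty and bounded. Put $X:=\{x:\exists y\in\mathbb{R}^m,\ (x,y)\in D\}$ and $Y:=\{y:\exists x\in\mathbb{R}^n,\ (x,y)\in D\}$, and let $S:X\rightrightarrows Y$ be the set-valued map $S(x):=\operatorname{argmin}_y\{c^\top y : Ax+By\le b\}$. For $x\in X$ let $\lambda_x$ be the Lebesgue measure over the affine space generated by $S(x)$ (of the dimension of that affine space), and let the neutral belief $\iota$ over $S$ be given by $$\iota_x(E):=\frac{\lambda_x(E\cap S(x))}{\lambda_x(S(x))}\qquad (E\subseteq Y \text{ Borel}).$$ For Borel probability measures $\mu,\nu$ on $Y$ let $$d_{W_1}(\mu,\nu):=\sup\Big\{\int f\,d\mu-\int f\,d\nu \;:\; f:Y\to\mathbb{R},\ |f(y)-f(y')|\le\|y-y'\|\ \ \forall y,y'\in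 Y\Big\}$$ be the Wasserstein-1 distance. Then, for every $x\in X$, $\iota_x$ is a well-defined Borel probability measure on $Y$ with $\iota_x(S(x))=1$, and $\iota$ is Lipschitz with respect to $d_{W_1}$: there is a constant $L\ge 0$ such that $$d_{W_1}(\iota_x,\iota_{x'})\le L\,\|x-x'\|\qquad\text{for all } x,x'\in X.$$ -/

import Mathlib

open MeasureTheory Matrix
open scoped ENNReal NNReal

/-- Lebesgue measure over the affine space generated by `s`, seen as a measure on the whole space:
`μHE[d]` is the `d`-dimensional Hausdorff measure normalized to agree with Lebesgue measure on
`d`-dimensional Euclidean spaces, and `d` is the dimension of the affine hull of `s`. -/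
noncomputable def affineLebesgue {m : ℕ} (s : Set (EuclideanSpace ℝ (Fin m))) :
    Measure (EuclideanSpace ℝ (Fin m)) :=
  (μHE[Module.finrank ℝ (affineSpan ℝ s).direction]).restrict (affineSpan ℝ s)

/-- The neutral belief over a set-valued map `S : X ⇉ Y`, where `Y ⊆ ℝᵐ`:
`ι_x(A) = λ_x(A ∩ S x) / λ_x(S x)` for Borel `A ⊆ Y`, with `λ_x` the Lebesgue measure over the
affine space generated by `S x`. -/
noncomputable def neutralBelief {X : Type*} {m : ℕ} {Y : Set (EuclideanSpace ℝ (Fin m))}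
    (S : X → Set Y) (x : X) : Measure Y :=
  (ProbabilityTheory.cond (affineLebesgue (Subtype.val '' S x)) (Subtype.val '' S x)).comap
    Subtype.val

/-- `β` is a belief over `S`: each `β x` is a probability measure that concentrates on `S x`. -/
def IsBelief {X Y : Type*} [MeasurableSpace Y] (S : X → Set Y) (β : X → Measure Y) : Prop :=
  ∀ x, IsProbabilityMeasure (β x) ∧ β x (S x) = 1

/-- The Wasserstein-1 distance: the supremum of `𝔼_μ[f] - 𝔼_ν[f]` over the real functions `f`
on `Y` that are Lipschitz with constant `1`. It is taken in `[0, ∞]`, so that an unbounded family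
has supremum `∞`; the pair `f`, `-f` makes negative values irrelevant. -/
noncomputable def wasserstein1 {Y : Type*} [PseudoEMetricSpace Y] [MeasurableSpace Y]
    (μ ν : Measure Y) : ℝ≥0∞ :=
  ⨆ (f : Y → ℝ) (_ : LipschitzWith 1 f), ENNReal.ofReal (∫ y, f y ∂μ - ∫ y, f y ∂ν)

/-- The feasible set `D = {(x, y) : A x + B y ≤ b}`. -/
def feasibleSet {n m p : ℕ} (A : Matrix (Fin p) (Fin n) ℝ) (B : Matrix (Fin p) (Fin m) ℝ)
    (b : Fin p → ℝ) : Set (EuclideanSpace ℝ (Fin n) × EuclideanSpace ℝ (Fin m)) :=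
  {z | A *ᵥ z.1.ofLp + B *ᵥ z.2.ofLp ≤ b}

/-- The projection `X` of `D` to the first factor. -/
def projX {n m p : ℕ} (A : Matrix (Fin p) (Fin n) ℝ) (B : Matrix (Fin p) (Fin m) ℝ)
    (b : Fin p → ℝ) : Set (EuclideanSpace ℝ (Fin n)) :=
  {x | ∃ y, (x, y) ∈ feasibleSet A B b}

/-- The projection `Y` of `D` to the second factor. -/
def projY {n m p : ℕ} (A : Matrix (Fin p) (Fin n) ℝ) (B : Matrix (Fin p) (Fin m) ℝ)
    (b : Fin p → ℝ) : Set (EuclideanSpace ℝ (Fin m)) :=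
  {y | ∃ x, (x, y) ∈ feasibleSet A B b}

/-- The set-valued map `S : X ⇉ Y`, `S(x) = argmin_y {cᵀ y : A x + B y ≤ b}`. -/
def solutionMap {n m p : ℕ} (A : Matrix (Fin p) (Fin n) ℝ) (B : Matrix (Fin p) (Fin m) ℝ)
    (b : Fin p → ℝ) (c : Fin m → ℝ) (x : projX A B b) : Set (projY A B b) :=
  {y | (x.1, y.1) ∈ feasibleSet A B b ∧
    ∀ z : EuclideanSpace ℝ (Fin m), (x.1, z) ∈ feasibleSet A B b → c ⬝ᵥ y.1.ofLp ≤ c ⬝ᵥ z.ofLp}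

/-! ### Averages over convex sets in the dimension of their affine hull -/

section AffineAverage

variable {E F : Type*} [NormedAddCommGroup E] [InnerProductSpace ℝ E] [MeasurableSpace E]
  [BorelSpace E] [NormedAddCommGroup F] [InnerProductSpace ℝ F] [MeasurableSpace F] [BorelSpace F]

/-! The fiber of D over x is a polyhedron with fixed normals and right-hand side affine in x. Adding
the optimal value as one more right-hand side makes S(x) a polyhedron with fixed normals too. So two
facts suffice: averages of 1-Lipschitz functions over bounded polyhedra {a_i y ≤ u_i} are Lipschitz
in u (`exists_averageLipschitz`), and so is the optimal value (`exists_minimum_lipschitz`, from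
Hoffman's bound `exists_hoffmanBound`). The average bound and Hoffman's bound go by induction on the
dimension: a slice a_i = t is a polyhedron in ker a_i whose right-hand side is affine in (t, u).

The crux is `abs_affineAverage_sub_le_of_interior`. Raise a single u_i by s, so that P grows to Q,
and let l be the distance from the minimum of a_i on Q to the new bound. By induction the slice
averages of f vary by O(l). If s < l, a homothety shows that Q \ P occupies at most a fraction d·s/l
of the volume of Q, where d is the dimension. The average therefore moves by O(l)·O(s/l) = O(s),
however thin Q is. If s = l, then P is the bottom slice and O(l) is enough. If Q has empty interior,
it lies in some hyperplane a_j = v_j and the bound for slices applies directly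
(`AverageLipschitz.of_slices`). -/

/-- The dimension of the affine hull of `s`. -/
noncomputable def affineDim (s : Set E) : ℕ := Module.finrank ℝ (affineSpan ℝ s).direction

/-- The average of `f` over `s` with respect to Lebesgue measure on the affine hull of `s`. -/
noncomputable def affineAverage (s : Set E) (f : E → ℝ) : ℝ := ⨍ x in s, f x ∂μHE[affineDim s]

omit [MeasurableSpace E] [BorelSpace E] [MeasurableSpace F] [BorelSpace F] in
theorem affineDim_image (φ : F →ᵃⁱ[ℝ] E) (s : Set F) : affineDim (φ '' s) = affineDim s := by
  have h : affineSpan ℝ (φ '' s) = (affineSpan ℝ s).map φ.toAffineMap := by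
    rw [AffineSubspace.map_span]; rfl
  rw [affineDim, affineDim, h, AffineSubspace.map_direction]
  exact (LinearEquiv.finrank_eq (Submodule.equivMapOfInjective _ φ.linearIsometry.injective _)).symm

theorem affineAverage_image [CompleteSpace F] (φ : F →ᵃⁱ[ℝ] E) (s : Set F) (f : E → ℝ) :
    affineAverage (φ '' s) f = affineAverage s (f ∘ φ) := by
  have hφ := φ.isometry
  have hm : MeasurableEmbedding φ := hφ.isClosedEmbedding.measurableEmbedding
  rw [affineAverage, affineAverage, affineDim_image, setAverage_eq, setAverage_eq,
    measureReal_def, measureReal_def, hφ.euclideanHausdorffMeasure_image]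
  congr 1
  have h1 := hm.setIntegral_map (μ := μHE[affineDim s]) f (φ '' s)
  rw [hφ.map_euclideanHausdorffMeasure, Measure.restrict_restrict_of_subset
    (Set.image_subset_range _ _), Set.preimage_image_eq _ hφ.injective] at h1
  exact h1

/-- Seen inside the direction of its affine hull, a nonempty convex set spans everything and so has
interior points; the isometric embedding preserves the Hausdorff measure. -/
theorem measure_affineDim_pos_lt_top [FiniteDimensional ℝ E] {s : Set E} (hs : Convex ℝ s)
    (hc : IsCompact s) (hne : s.Nonempty) :
    0 < (μHE[affineDim s] : Measure E) s ∧ (μHE[affineDim s] : Measure E) s < ∞ := by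
  obtain ⟨x₀, hx₀⟩ := hne
  let V := (affineSpan ℝ s).direction
  let φ : V →ᵃⁱ[ℝ] E :=
    (AffineIsometryEquiv.vaddConst ℝ x₀).toAffineIsometry.comp V.subtypeₗᵢ.toAffineIsometry
  have hφ : ∀ v : V, φ v = (v : E) + x₀ := fun v => rfl
  have himg : φ '' (φ ⁻¹' s) = s := by
    refine Set.image_preimage_eq_of_subset fun y hy => ?_
    refine ⟨⟨y - x₀, ?_⟩, by simp [hφ]⟩
    exact AffineSubspace.vsub_mem_direction (subset_affineSpan ℝ s hy) (subset_affineSpan ℝ s hx₀)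
  set s' := φ ⁻¹' s
  have hconv : Convex ℝ s' := hs.affine_preimage φ.toAffineMap
  have hcomp : IsCompact s' := φ.isometry.isClosedEmbedding.isCompact_preimage hc
  have hne' : s'.Nonempty := ⟨0, by simpa [s', hφ] using hx₀⟩
  have hdim : affineDim s = affineDim s' := by rw [← affineDim_image φ s', himg]
  have hfull : Module.finrank ℝ V = affineDim s' := hdim ▸ rfl
  have hint : (interior s').Nonempty := by
    rw [hconv.interior_nonempty_iff_affineSpan_eq_top, ← AffineSubspace.direction_eq_top_iff_of_nonempty
      ((affineSpan_nonempty ℝ).2 hne')]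
    exact Submodule.eq_top_of_finrank_eq hfull.symm
  rw [hdim, ← himg, φ.isometry.euclideanHausdorffMeasure_image, ← hfull]
  exact ⟨Measure.measure_pos_of_nonempty_interior _ hint, hcomp.measure_lt_top⟩

theorem abs_affineAverage_sub_le [FiniteDimensional ℝ E] {s : Set E} (hs : Convex ℝ s)
    (hc : IsCompact s) (hne : s.Nonempty) {f g : E → ℝ} (hf : Continuous f) (hg : Continuous g)
    {D : ℝ} (h : ∀ x ∈ s, |f x - g x| ≤ D) : |affineAverage s f - affineAverage s g| ≤ D := by
  obtain ⟨h0, h1⟩ := measure_affineDim_pos_lt_top hs hc hne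
  have hpos : 0 < (μHE[affineDim s] : Measure E).real s := ENNReal.toReal_pos h0.ne' h1.ne
  have hi : ∀ {f : E → ℝ}, Continuous f → IntegrableOn f s μHE[affineDim s] := fun hf => by
    obtain ⟨C, hC⟩ := hc.exists_bound_of_continuousOn hf.continuousOn
    exact Measure.integrableOn_of_bounded h1.ne hf.aestronglyMeasurable
      ((ae_restrict_iff' hc.measurableSet).2 (ae_of_all _ hC))
  rw [affineAverage, affineAverage, setAverage_eq, setAverage_eq, ← smul_sub,
    ← integral_sub (hi hf) (hi hg), smul_eq_mul, abs_mul, abs_of_pos (inv_pos.2 hpos),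
    inv_mul_le_iff₀ hpos, mul_comm]
  have := norm_setIntegral_le_of_norm_le_const (f := fun x => f x - g x) h1 h
  exact this

end AffineAverage

/-! ### Fubini along the hyperplanes a = t -/

section Slices

variable {E : Type*} [NormedAddCommGroup E] [InnerProductSpace ℝ E]

/-- The affine isometry `z ↦ z + t • w` from the kernel of `a` into the ambient space. Its range is
the hyperplane `a = t` if `a w = 1`. -/
noncomputable def sliceMap (a : E →L[ℝ] ℝ) (w : E) (t : ℝ) :
    LinearMap.ker a.toLinearMap →ᵃⁱ[ℝ] E :=
  (AffineIsometryEquiv.vaddConst ℝ (t • w)).toAffineIsometry.comp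
    (LinearMap.ker a.toLinearMap).subtypeₗᵢ.toAffineIsometry

theorem sliceMap_apply (a : E →L[ℝ] ℝ) (w : E) (t : ℝ) (z : LinearMap.ker a.toLinearMap) :
    sliceMap a w t z = z + t • w := rfl

theorem map_sliceMap {a : E →L[ℝ] ℝ} {w : E} (hw : a w = 1) (t : ℝ)
    (z : LinearMap.ker a.toLinearMap) : a (sliceMap a w t z) = t := by
  have : a (z : E) = 0 := z.2
  simp [sliceMap_apply, this, hw]

theorem image_preimage_sliceMap {a : E →L[ℝ] ℝ} {w : E} (hw : a w = 1) (t : ℝ) (s : Set E) :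
    sliceMap a w t '' (sliceMap a w t ⁻¹' s) = {y ∈ s | a y = t} := by
  ext y
  constructor
  · rintro ⟨z, hz, rfl⟩
    exact ⟨hz, map_sliceMap hw t z⟩
  · rintro ⟨hy, hyt⟩
    have hz : y - t • w ∈ LinearMap.ker a.toLinearMap := by simp [hw, hyt]
    have he : sliceMap a w t ⟨y - t • w, hz⟩ = y := by simp [sliceMap_apply]
    exact ⟨⟨y - t • w, hz⟩, by rwa [Set.mem_preimage, he], he⟩

/-- The linear equivalence `(z, t) ↦ z + t • w` between `ker a × ℝ` and the ambient space. -/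
noncomputable def kerProdEquiv [FiniteDimensional ℝ E] {a : E →L[ℝ] ℝ} {w : E} (hw : a w = 1) :
    (LinearMap.ker a.toLinearMap × ℝ) ≃L[ℝ] E :=
  LinearEquiv.toContinuousLinearEquiv
    { toFun := fun q => q.1 + q.2 • w
      map_add' := fun q r => by simp only [Prod.fst_add, Prod.snd_add, Submodule.coe_add]; module
      map_smul' := fun k q => by simp [smul_smul]
      invFun := fun y => (⟨y - a y • w, by simp [hw]⟩, a y)
      left_inv := fun q => by
        have : a (q.1 : E) = 0 := q.1.2
        ext <;> simp [this, hw]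
      right_inv := fun y => by simp }

variable [MeasurableSpace E] [BorelSpace E] [FiniteDimensional ℝ E]

/-- Uniqueness of Haar measure identifies the measure with the product measure on ker a × ℝ up to a
factor. Its value is irrelevant, since it appears on both sides of the estimates. -/
theorem exists_integral_eq_mul_integral_sliceMap {a : E →L[ℝ] ℝ} {w : E} (hw : a w = 1) :
    ∃ c : ℝ≥0, ∀ g : E → ℝ, Integrable g μHE[Module.finrank ℝ E] →
      Integrable (fun t => ∫ z, g (sliceMap a w t z)
        ∂μHE[Module.finrank ℝ (LinearMap.ker a.toLinearMap)]) ∧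
      ∫ y, g y ∂μHE[Module.finrank ℝ E] = c * ∫ t, ∫ z, g (sliceMap a w t z)
        ∂μHE[Module.finrank ℝ (LinearMap.ker a.toLinearMap)] := by
  set μK : Measure (LinearMap.ker a.toLinearMap) :=
    μHE[Module.finrank ℝ (LinearMap.ker a.toLinearMap)]
  set μ : Measure E := μHE[Module.finrank ℝ E]
  have : SigmaFinite μK := inferInstance
  let e := kerProdEquiv hw
  let ν : Measure E := (μK.prod (volume : Measure ℝ)).map e
  have hem : MeasurableEmbedding e := e.toHomeomorph.measurableEmbedding
  obtain ⟨c, hμ⟩ : ∃ c : ℝ≥0, μ = c • ν := ⟨_, Measure.isAddLeftInvariant_eq_smul μ ν⟩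
  -- Proportionality in the other direction carries integrability from `μ` to `ν`.
  have hν := Measure.isAddLeftInvariant_eq_smul ν μ
  refine ⟨c, fun g hg => ?_⟩
  have hgν : Integrable g ν := by
    rw [hν]
    exact hg.smul_measure_nnreal
  have hgp : Integrable (g ∘ e) (μK.prod volume) := (hem.integrable_map_iff).1 hgν
  refine ⟨hgp.integral_prod_right, ?_⟩
  rw [hμ, integral_smul_nnreal_measure, hem.integral_map]
  rw [NNReal.smul_def, smul_eq_mul]
  congr 1
  exact integral_prod_symm _ hgp

/-- A bound for the integrals over the slices of a set gives a bound for the integral over it. -/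
theorem abs_setIntegral_le_of_sliceMap {a : E →L[ℝ] ℝ} {w : E} (hw : a w = 1) {s : Set E}
    (hs : MeasurableSet s) (hfin : (μHE[Module.finrank ℝ E] : Measure E) s ≠ ∞) {g : E → ℝ}
    (hg : IntegrableOn g s μHE[Module.finrank ℝ E]) {M : ℝ}
    (h : ∀ t, |∫ z in sliceMap a w t ⁻¹' s, g (sliceMap a w t z)
        ∂μHE[Module.finrank ℝ (LinearMap.ker a.toLinearMap)]| ≤
      M * (μHE[Module.finrank ℝ (LinearMap.ker a.toLinearMap)] :
        Measure (LinearMap.ker a.toLinearMap)).real (sliceMap a w t ⁻¹' s)) :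
    |∫ y in s, g y ∂μHE[Module.finrank ℝ E]| ≤
      M * (μHE[Module.finrank ℝ E] : Measure E).real s := by
  obtain ⟨c, hc⟩ := exists_integral_eq_mul_integral_sliceMap hw
  have hpre : ∀ t, MeasurableSet (sliceMap a w t ⁻¹' s) := fun t =>
    (sliceMap a w t).isometry.continuous.measurable hs
  have hind : ∀ (k : E → ℝ) t, (∫ z, s.indicator k (sliceMap a w t z)
      ∂μHE[Module.finrank ℝ (LinearMap.ker a.toLinearMap)]) =
      ∫ z in sliceMap a w t ⁻¹' s, k (sliceMap a w t z)
        ∂μHE[Module.finrank ℝ (LinearMap.ker a.toLinearMap)] := fun k t => by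
    rw [← integral_indicator (hpre t)]
    rfl
  have hone : IntegrableOn (fun _ : E => (1 : ℝ)) s μHE[Module.finrank ℝ E] :=
    integrableOn_const hfin
  obtain ⟨-, h1⟩ := hc _ ((integrable_indicator_iff hs).2 hg)
  obtain ⟨i2, h2⟩ := hc _ ((integrable_indicator_iff hs).2 hone)
  have hvol : (μHE[Module.finrank ℝ E] : Measure E).real s =
      ∫ y, s.indicator (fun _ => (1 : ℝ)) y ∂μHE[Module.finrank ℝ E] := by
    rw [integral_indicator hs]; simp
  rw [hvol, h2, ← integral_indicator hs, h1, abs_mul, abs_of_nonneg c.coe_nonneg, mul_left_comm,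
    ← integral_const_mul]
  refine mul_le_mul_of_nonneg_left ?_ c.coe_nonneg
  refine norm_integral_le_of_norm_le (f := fun t => ∫ z, s.indicator g (sliceMap a w t z)
    ∂μHE[Module.finrank ℝ (LinearMap.ker a.toLinearMap)]) (i2.const_mul M) (ae_of_all _ fun t => ?_)
  rw [hind, hind, Real.norm_eq_abs]
  simpa using h t

end Slices

/-! ### Averages and integrals in full dimension -/

section FullDimensional

variable {E : Type*} [NormedAddCommGroup E] [InnerProductSpace ℝ E] [MeasurableSpace E]
  [BorelSpace E] [FiniteDimensional ℝ E]

theorem affineAverage_sub_eq {s : Set E} (hc : IsCompact s)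
    (h0 : (μHE[Module.finrank ℝ E] : Measure E) s ≠ 0) {f : E → ℝ} (hf : Continuous f) (c : ℝ) :
    affineAverage s f - c = ((μHE[Module.finrank ℝ E] : Measure E).real s)⁻¹ *
      ∫ y in s, (f y - c) ∂μHE[Module.finrank ℝ E] := by
  set μ : Measure E := μHE[Module.finrank ℝ E]
  -- Proper affine subspaces are null, so positive measure forces the affine hull to be everything.
  have hspan : affineSpan ℝ s = ⊤ := by
    by_contra hspan
    exact h0 (measure_mono_null (subset_affineSpan ℝ s) (Measure.addHaar_affineSubspace μ _ hspan))
  have hdim : affineDim s = Module.finrank ℝ E := by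
    rw [affineDim, hspan, AffineSubspace.direction_top, finrank_top]
  have hfin : μ s ≠ ∞ := hc.measure_lt_top.ne
  have hpos : 0 < μ.real s := ENNReal.toReal_pos h0 hfin
  rw [integral_sub (hf.continuousOn.integrableOn_compact hc) (integrableOn_const hfin),
    affineAverage, hdim, setAverage_eq, setIntegral_const]
  change (μ.real s)⁻¹ • (∫ y in s, f y ∂μ) - c = _
  simp only [smul_eq_mul]
  field_simp

/-- A null set contributes nothing on either side, so a slice of too small dimension does no harm
although its average uses another measure. -/
theorem abs_setIntegral_sub_le {s : Set E} (hc : IsCompact s) {f : E → ℝ}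
    (hf : Continuous f) {c M : ℝ} (h : s.Nonempty → |affineAverage s f - c| ≤ M) :
    |∫ y in s, (f y - c) ∂μHE[Module.finrank ℝ E]| ≤
      M * (μHE[Module.finrank ℝ E] : Measure E).real s := by
  set μ : Measure E := μHE[Module.finrank ℝ E] with hμ
  by_cases h0 : μ s = 0
  · rw [Measure.restrict_eq_zero.2 h0]
    simp [measureReal_def, h0]
  have hne : s.Nonempty := Set.nonempty_iff_ne_empty.2 fun h => h0 (by simp [h])
  have hpos : 0 < μ.real s := ENNReal.toReal_pos h0 hc.measure_lt_top.ne
  have := h hne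
  rwa [affineAverage_sub_eq hc h0 hf c, abs_mul, abs_of_pos (inv_pos.2 hpos),
    inv_mul_le_iff₀ hpos, mul_comm] at this

end FullDimensional

/-! ### Polyhedra with fixed normals and their slices -/

section Polyhedron

variable {E : Type*} [NormedAddCommGroup E] [InnerProductSpace ℝ E] {ι : Type*}

/-- The polyhedron cut out by the inequalities `a i y ≤ u i`. -/
def polyhedron (a : ι → E →L[ℝ] ℝ) (u : ι → ℝ) : Set E := {y | ∀ i, a i y ≤ u i}

theorem convex_polyhedron (a : ι → E →L[ℝ] ℝ) (u : ι → ℝ) : Convex ℝ (polyhedron a u) := by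
  rw [polyhedron, Set.ofPred_forall]
  exact convex_iInter fun i => convex_halfSpace_le (a i).isLinear (u i)

theorem isClosed_polyhedron (a : ι → E →L[ℝ] ℝ) (u : ι → ℝ) : IsClosed (polyhedron a u) := by
  rw [polyhedron, Set.ofPred_forall]
  exact isClosed_iInter fun i => isClosed_le (a i).continuous continuous_const

theorem polyhedron_mono (a : ι → E →L[ℝ] ℝ) {u v : ι → ℝ} (h : u ≤ v) :
    polyhedron a u ⊆ polyhedron a v := fun _ hy i => (hy i).trans (h i)

/-- The restrictions of the functionals `a i` to the kernel of `a j`. -/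
noncomputable def kerRestrict (a : ι → E →L[ℝ] ℝ) (j : ι) (i : ι) :
    LinearMap.ker (a j).toLinearMap →L[ℝ] ℝ :=
  (a i).comp (LinearMap.ker (a j).toLinearMap).subtypeL

theorem preimage_sliceMap_polyhedron (a : ι → E →L[ℝ] ℝ) (j : ι) (w : E) (t : ℝ) (u : ι → ℝ) :
    sliceMap (a j) w t ⁻¹' polyhedron a u =
      polyhedron (kerRestrict a j) (fun i => u i - t * a i w) := by
  ext z
  simp only [Set.mem_preimage, polyhedron, Set.mem_ofPred_eq, sliceMap_apply, kerRestrict, map_add,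
    map_smul, smul_eq_mul, ContinuousLinearMap.comp_apply, Submodule.subtypeL_apply]
  exact forall_congr' fun i => le_sub_iff_add_le.symm

theorem isBounded_polyhedron_kerRestrict {a : ι → E →L[ℝ] ℝ}
    (hb : ∀ u, Bornology.IsBounded (polyhedron a u)) (j : ι) (u : ι → ℝ) :
    Bornology.IsBounded (polyhedron (kerRestrict a j) u) := by
  -- With `w = 0` and `t = 0` the slice map is the inclusion of the kernel.
  have h := preimage_sliceMap_polyhedron a j 0 0 u
  simp only [zero_mul, sub_zero] at h
  rw [← h]
  exact (sliceMap (a j) 0 0).isometry.antilipschitz.isBounded_preimage (hb u)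

theorem exists_map_eq_one {a : E →L[ℝ] ℝ} (ha : a ≠ 0) : ∃ w, a w = 1 := by
  obtain ⟨v, hv⟩ := DFunLike.ne_iff.1 ha
  exact ⟨(a v)⁻¹ • v, by simpa using inv_mul_cancel₀ hv⟩

/-- The intersection of a polyhedron with the hyperplane `a j = t`. -/
def polyhedronSlice (a : ι → E →L[ℝ] ℝ) (j : ι) (t : ℝ) (u : ι → ℝ) : Set E :=
  {y ∈ polyhedron a u | a j y = t}

theorem polyhedronSlice_eq_image (a : ι → E →L[ℝ] ℝ) {j : ι} {w : E} (hw : a j w = 1) (t : ℝ)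
    (u : ι → ℝ) : polyhedronSlice a j t u =
      sliceMap (a j) w t '' polyhedron (kerRestrict a j) (fun i => u i - t * a i w) := by
  rw [polyhedronSlice, ← image_preimage_sliceMap hw, preimage_sliceMap_polyhedron]

variable [Fintype ι]

theorem dist_slice_parameters_le (a : ι → E →L[ℝ] ℝ) (w : E) (t t' : ℝ) (u u' : ι → ℝ) :
    dist (fun i => u i - t * a i w) (fun i => u' i - t' * a i w) ≤
      dist u u' + |t - t'| * ‖fun i => a i w‖ := by
  have h : ((fun i => u i - t * a i w) - fun i => u' i - t' * a i w) =
      (u - u') - (t - t') • fun i => a i w := by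
    ext i; simp; ring
  rw [dist_eq_norm, dist_eq_norm, h]
  refine (norm_sub_le _ _).trans (by rw [norm_smul, Real.norm_eq_abs])

/-- A nonempty polyhedron has interior points unless one of the inequalities is an equality on the
whole polyhedron. -/
theorem interior_polyhedron_nonempty_or (a : ι → E →L[ℝ] ℝ) (u : ι → ℝ)
    (hne : (polyhedron a u).Nonempty) : (interior (polyhedron a u)).Nonempty ∨
      ∃ j, a j ≠ 0 ∧ ∀ y ∈ polyhedron a u, a j y = u j := by
  classical
  by_cases h : ∃ j, a j ≠ 0 ∧ ∀ y ∈ polyhedron a u, a j y = u j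
  · exact Or.inr h
  push Not at h
  refine Or.inl ?_
  -- Midpoints collect strictness: a constraint strict at one endpoint is strict at the midpoint.
  have key : ∀ s : Finset ι, ∃ y ∈ polyhedron a u, ∀ j ∈ s, a j ≠ 0 → a j y < u j := by
    intro s
    induction s using Finset.induction_on with
    | empty => exact hne.imp fun y hy => ⟨hy, by simp⟩
    | insert j s _ ih =>
      obtain ⟨y, hy, hys⟩ := ih
      by_cases hj : a j = 0
      · refine ⟨y, hy, fun k hk hk0 => ?_⟩
        rcases Finset.mem_insert.1 hk with rfl | hk
        exacts [absurd hj hk0, hys k hk hk0]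
      obtain ⟨z, hz, hzj⟩ := h j hj
      have hzj' : a j z < u j := lt_of_le_of_ne (hz j) hzj
      refine ⟨(1 / 2 : ℝ) • y + (1 / 2 : ℝ) • z, convex_polyhedron a u hy hz (by norm_num)
        (by norm_num) (by norm_num), fun k hk hk0 => ?_⟩
      simp only [map_add, map_smul, smul_eq_mul]
      rcases Finset.mem_insert.1 hk with rfl | hk
      · linarith [hy k]
      · linarith [hz k, hys k hk hk0]
  obtain ⟨y, hy, hys⟩ := key Finset.univ
  refine ⟨y, mem_interior.2 ⟨{z | ∀ j, a j ≠ 0 → a j z < u j}, fun z hz j => ?_, ?_,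
    fun j => hys j (Finset.mem_univ j)⟩⟩
  · by_cases hj : a j = 0
    · have := hy j
      simp only [hj, _root_.zero_apply] at this ⊢
      exact this
    · exact (hz j hj).le
  · simp only [Set.ofPred_forall]
    exact isOpen_iInter_of_finite fun j => isOpen_iInter_of_finite fun _ =>
      isOpen_lt (a j).continuous continuous_const

/-- An estimate for increments of a single coordinate extends to increasing tuples. -/
theorem le_card_mul_of_le_update {R : (ι → ℝ) → (ι → ℝ) → ℝ → Prop} {u v : ι → ℝ} (huv : u ≤ v)
    {C : ℝ} (hrefl : R u u 0)
    (hstep : ∀ w x e, u ≤ w → w ≤ x → x ≤ v → dist w x ≤ dist u v →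
      (∃ i, ∀ j, j ≠ i → x j = w j) → R u w e → R u x (e + C * dist u v)) :
    R u v (Fintype.card ι * (C * dist u v)) := by
  classical
  -- The coordinates in `s` have already been raised from `u` to `v`.
  have key : ∀ s : Finset ι, R u (s.piecewise v u) (s.card * (C * dist u v)) := by
    intro s
    induction s using Finset.induction_on with
    | empty => simpa using hrefl
    | insert i s hi ih =>
      rw [Finset.card_insert_of_notMem hi, Nat.cast_add, Nat.cast_one, add_mul, one_mul]
      have hle : ∀ j, u j ≤ v j := huv
      refine hstep _ _ _ ?_ ?_ ?_ ?_ ⟨i, fun j hj => ?_⟩ ih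
      · intro j; simp only [Finset.piecewise]; split_ifs <;> simp [hle j]
      · intro j
        simp only [Finset.piecewise, Finset.mem_insert]
        split_ifs <;> first | exact le_rfl | exact hle j | tauto
      · intro j; simp only [Finset.piecewise]; split_ifs <;> simp [hle j]
      · refine (dist_pi_le_iff dist_nonneg).2 fun j => ?_
        simp only [Finset.piecewise, Finset.mem_insert]
        split_ifs <;> first | exact dist_le_pi_dist u v j | simp | tauto
      · simp [Finset.piecewise, hj]
  simpa [Finset.card_univ] using key Finset.univ

end Polyhedron

/-! ### Changing one right-hand side -/

section AverageLipschitz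

variable {E : Type*} [NormedAddCommGroup E] [InnerProductSpace ℝ E] [MeasurableSpace E]
  [BorelSpace E] {ι : Type*} [Fintype ι]

/-- The averages of `1`-Lipschitz functions over the polyhedra with normals `a` depend on the right
hand sides in a Lipschitz way with constant `C`. -/
def AverageLipschitz (a : ι → E →L[ℝ] ℝ) (C : ℝ) : Prop :=
  ∀ u u', (polyhedron a u).Nonempty → (polyhedron a u').Nonempty → ∀ f : E → ℝ, LipschitzWith 1 f →
    |affineAverage (polyhedron a u) f - affineAverage (polyhedron a u') f| ≤ C * dist u u'

/-- The version of `AverageLipschitz` for slices of polyhedra by hyperplanes parallel to the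
hyperplane `a j = 0`. -/
def SliceAverageLipschitz (a : ι → E →L[ℝ] ℝ) (j : ι) (C : ℝ) : Prop :=
  ∀ t t' u u', (polyhedronSlice a j t u).Nonempty → (polyhedronSlice a j t' u').Nonempty →
    ∀ f : E → ℝ, LipschitzWith 1 f →
      |affineAverage (polyhedronSlice a j t u) f - affineAverage (polyhedronSlice a j t' u') f| ≤
        C * (|t - t'| + dist u u')

variable [FiniteDimensional ℝ E]

/-- Two effects add up: the polyhedron in the kernel changes with right-hand side `u - t * a w`, and
the translation by `(t - t') • w` changes `f` by at most `|t - t'| * ‖w‖`. -/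
theorem AverageLipschitz.slice {a : ι → E →L[ℝ] ℝ} (hb : ∀ u, Bornology.IsBounded (polyhedron a u))
    {j : ι} (hj : a j ≠ 0) {C : ℝ} (hC : 0 ≤ C) (h : AverageLipschitz (kerRestrict a j) C) :
    ∃ C', 0 ≤ C' ∧ SliceAverageLipschitz a j C' := by
  obtain ⟨w, hw⟩ := exists_map_eq_one hj
  set N := ‖fun i => a i w‖
  have hN : 0 ≤ N := norm_nonneg _
  refine ⟨‖w‖ + C * N + C, by positivity, fun t t' u u' hne hne' f hf => ?_⟩
  rw [polyhedronSlice_eq_image a hw] at hne hne' ⊢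
  rw [polyhedronSlice_eq_image a hw, affineAverage_image, affineAverage_image]
  rw [Set.image_nonempty] at hne hne'
  have hlip : ∀ t, LipschitzWith 1 (f ∘ sliceMap (a j) w t) := fun t => by
    simpa using hf.comp (sliceMap (a j) w t).isometry.lipschitz
  have h1 := h _ _ hne hne' _ (hlip t)
  have h2 := abs_affineAverage_sub_le (convex_polyhedron _ _)
    (Metric.isCompact_of_isClosed_isBounded (isClosed_polyhedron _ _)
      (isBounded_polyhedron_kerRestrict hb j _)) hne' (hlip t).continuous (hlip t').continuous
    (D := |t - t'| * ‖w‖) fun z _ => by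
      have := hf.dist_le_mul (sliceMap (a j) w t z) (sliceMap (a j) w t' z)
      rw [NNReal.coe_one, one_mul, Real.dist_eq, dist_eq_norm, sliceMap_apply, sliceMap_apply,
        add_sub_add_left_eq_sub, ← sub_smul, norm_smul, Real.norm_eq_abs] at this
      exact this
  have h3 := mul_le_mul_of_nonneg_left (dist_slice_parameters_le a w t t' u u') hC
  have h4 := abs_sub_le (affineAverage (polyhedron (kerRestrict a j) fun i => u i - t * a i w)
    (f ∘ sliceMap (a j) w t)) (affineAverage (polyhedron (kerRestrict a j)
      fun i => u' i - t' * a i w) (f ∘ sliceMap (a j) w t))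
    (affineAverage (polyhedron (kerRestrict a j) fun i => u' i - t' * a i w)
      (f ∘ sliceMap (a j) w t'))
  have h5 : 0 ≤ C * |t - t'| := by positivity
  have h6 : 0 ≤ (‖w‖ + C * N) * dist u u' := by positivity
  change _ ≤ C * (dist u u' + |t - t'| * N) at h3
  linarith

omit [Fintype ι] in
theorem abs_setIntegral_polyhedron_sub_le {a : ι → E →L[ℝ] ℝ}
    (hb : ∀ u, Bornology.IsBounded (polyhedron a u)) {i : ι} (hi : a i ≠ 0) (u : ι → ℝ) {I : Set ℝ}
    (hI : MeasurableSet I) {f : E → ℝ} (hf : Continuous f) {c M : ℝ}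
    (h : ∀ t, (polyhedronSlice a i t u).Nonempty →
      |affineAverage (polyhedronSlice a i t u) f - c| ≤ M) :
    |∫ y in polyhedron a u ∩ a i ⁻¹' I, (f y - c) ∂μHE[Module.finrank ℝ E]| ≤
      M * (μHE[Module.finrank ℝ E] : Measure E).real (polyhedron a u ∩ a i ⁻¹' I) := by
  obtain ⟨w, hw⟩ := exists_map_eq_one hi
  have hc := Metric.isCompact_of_isClosed_isBounded (isClosed_polyhedron a u) (hb u)
  have hsub : polyhedron a u ∩ a i ⁻¹' I ⊆ polyhedron a u := Set.inter_subset_left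
  refine abs_setIntegral_le_of_sliceMap hw
    (hc.measurableSet.inter ((a i).continuous.measurable hI))
    ((measure_mono hsub).trans_lt hc.measure_lt_top).ne
    (((hf.sub continuous_const).continuousOn.integrableOn_compact hc).mono_set hsub) fun t => ?_
  by_cases ht : t ∈ I
  · have hpre : sliceMap (a i) w t ⁻¹' (polyhedron a u ∩ a i ⁻¹' I) =
        polyhedron (kerRestrict a i) (fun k => u k - t * a k w) := by
      rw [← preimage_sliceMap_polyhedron, Set.preimage_inter, Set.inter_eq_left]
      intro z _
      rw [Set.mem_preimage, Set.mem_preimage, map_sliceMap hw]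
      exact ht
    rw [hpre]
    refine abs_setIntegral_sub_le (f := f ∘ sliceMap (a i) w t)
      (Metric.isCompact_of_isClosed_isBounded (isClosed_polyhedron _ _)
        (isBounded_polyhedron_kerRestrict hb i _))
      (hf.comp (sliceMap (a i) w t).isometry.continuous) fun hne => ?_
    have := h t
    rw [polyhedronSlice_eq_image a hw, affineAverage_image] at this
    exact this (hne.image _)
  · have hpre : sliceMap (a i) w t ⁻¹' (polyhedron a u ∩ a i ⁻¹' I) = ∅ := by
      ext z
      simp only [Set.mem_preimage, Set.mem_inter_iff, map_sliceMap hw, ht, and_false,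
        Set.mem_empty_iff_false]
    simp [hpre]

omit [MeasurableSpace E] [BorelSpace E] [FiniteDimensional ℝ E] [Fintype ι] in
-- The image points are r x + (1 - r) y. The slack of x in constraint i, weighted by r, pays for
-- lowering the bound; the other constraints hold by convexity.
theorem homothety_image_polyhedron_subset {a : ι → E →L[ℝ] ℝ} {u v : ι → ℝ} {i : ι}
    (huv : ∀ j, j ≠ i → v j = u j) {x : E} (hx : x ∈ polyhedron a v) {r : ℝ} (hr0 : 0 ≤ r)
    (hr1 : r ≤ 1) (hi : v i - u i ≤ r * (v i - a i x)) :
    AffineMap.homothety x (1 - r) '' polyhedron a v ⊆ polyhedron a u := by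
  rintro _ ⟨y, hy, rfl⟩ j
  have he : a j (AffineMap.homothety x (1 - r) y) = r * a j x + (1 - r) * a j y := by
    simp [AffineMap.homothety_apply]; ring
  rw [he]
  have h1 := mul_le_mul_of_nonneg_left (hy j) (sub_nonneg.2 hr1)
  by_cases hj : j = i
  · subst hj; linarith
  · have h2 := mul_le_mul_of_nonneg_left (hx j) hr0
    have := huv j hj
    linarith

omit [Fintype ι] in
theorem measureReal_polyhedron_le {a : ι → E →L[ℝ] ℝ}
    (hb : ∀ u, Bornology.IsBounded (polyhedron a u)) {u v : ι → ℝ} {i : ι}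
    (huv : ∀ j, j ≠ i → v j = u j) {x : E} (hx : x ∈ polyhedron a v) {r : ℝ} (hr0 : 0 ≤ r)
    (hr1 : r ≤ 1) (hi : v i - u i ≤ r * (v i - a i x)) :
    (1 - r) ^ Module.finrank ℝ E * (μHE[Module.finrank ℝ E] : Measure E).real (polyhedron a v) ≤
      (μHE[Module.finrank ℝ E] : Measure E).real (polyhedron a u) := by
  set μ : Measure E := μHE[Module.finrank ℝ E]
  have hc := Metric.isCompact_of_isClosed_isBounded (isClosed_polyhedron a u) (hb u)
  have h := measureReal_mono (μ := μ) (homothety_image_polyhedron_subset huv hx hr0 hr1 hi)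
    hc.measure_lt_top.ne
  have hnn : 0 ≤ (1 - r) ^ Module.finrank ℝ E := pow_nonneg (sub_nonneg.2 hr1) _
  rwa [measureReal_def, Measure.addHaar_image_homothety, abs_of_nonneg hnn, ENNReal.toReal_mul,
    ENNReal.toReal_ofReal hnn, ← measureReal_def] at h

theorem abs_affineAverage_sub_le_of_interior {a : ι → E →L[ℝ] ℝ}
    (hb : ∀ u, Bornology.IsBounded (polyhedron a u)) {C : ℝ} (hC : 0 ≤ C) {i : ι} (hi : a i ≠ 0)
    (hS : SliceAverageLipschitz a i C) {u v : ι → ℝ} (huv : u ≤ v) (huv' : ∀ j, j ≠ i → v j = u j)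
    (hne : (polyhedron a u).Nonempty) (hint : (interior (polyhedron a v)).Nonempty) {f : E → ℝ}
    (hf : LipschitzWith 1 f) :
    |affineAverage (polyhedron a u) f - affineAverage (polyhedron a v) f| ≤
      C * (2 * Module.finrank ℝ E + 1) * (v i - u i) := by
  set μ : Measure E := μHE[Module.finrank ℝ E] with hμ
  set P := polyhedron a u with hP
  set Q := polyhedron a v with hQ
  have hPQ : P ⊆ Q := polyhedron_mono a huv
  have hPc : IsCompact P := Metric.isCompact_of_isClosed_isBounded (isClosed_polyhedron a u) (hb u)
  have hQc : IsCompact Q := Metric.isCompact_of_isClosed_isBounded (isClosed_polyhedron a v) (hb v)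
  have hQne : Q.Nonempty := hne.mono hPQ
  have hs0 : 0 ≤ v i - u i := sub_nonneg.2 (huv i)
  have hPeq : P = Q ∩ a i ⁻¹' Set.Iic (u i) := by
    ext y
    refine ⟨fun hy => ⟨hPQ hy, hy i⟩, fun hy j => ?_⟩
    by_cases hj : j = i
    · exact hj ▸ hy.2
    · exact huv' j hj ▸ hy.1 j
  -- The bottom point `x` serves twice: its slice gives the reference value `c`, and it is the
  -- center of the homothety.
  obtain ⟨x, hx, hmin⟩ := hQc.exists_isMinOn hQne (a i).continuous.continuousOn
  have hmin' : ∀ y ∈ Q, a i x ≤ a i y := fun y hy => hmin hy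
  set c := affineAverage (polyhedronSlice a i (a i x) v) f
  have hsl : ∀ t, (polyhedronSlice a i t v).Nonempty →
      |affineAverage (polyhedronSlice a i t v) f - c| ≤ C * (v i - a i x) := by
    rintro t ⟨y, hy, hyt⟩
    refine (hS t (a i x) v v ⟨y, hy, hyt⟩ ⟨x, hx, rfl⟩ f hf).trans ?_
    rw [dist_self, add_zero]
    refine mul_le_mul_of_nonneg_left ?_ hC
    rw [abs_of_nonneg (by linarith [hmin' y hy])]
    linarith [hy i]
  have hVpos : 0 < μ.real Q :=
    ENNReal.toReal_pos (Measure.measure_pos_of_nonempty_interior _ hint).ne' hQc.measure_lt_top.ne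
  have hQavg := affineAverage_sub_eq hQc
    (Measure.measure_pos_of_nonempty_interior _ hint).ne' hf.continuous c
  rw [← hμ] at hQavg
  have hIQ := abs_setIntegral_polyhedron_sub_le hb hi v MeasurableSet.univ hf.continuous hsl
  have hIP := abs_setIntegral_polyhedron_sub_le hb hi v (measurableSet_Iic (a := u i))
    hf.continuous hsl
  have hID := abs_setIntegral_polyhedron_sub_le hb hi v (measurableSet_Iic (a := u i)).compl
    hf.continuous hsl
  rw [Set.preimage_univ, Set.inter_univ, ← hQ, ← hμ] at hIQ
  rw [← hQ, ← hPeq, ← hμ] at hIP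
  have hdiff : Q ∩ a i ⁻¹' (Set.Iic (u i))ᶜ = Q \ P := by
    rw [hPeq, Set.sdiff_self_inter, Set.preimage_compl, Set.sdiff_eq]
  rw [← hQ, hdiff, ← hμ] at hID
  -- In the first case `P`, being nonempty, is exactly the bottom slice, so its average is `c`.
  rcases le_or_gt (u i) (a i x) with hcase | hcase
  · have hxe : ∀ y ∈ P, a i y = a i x := fun y hy =>
      le_antisymm ((hy i).trans hcase) (hmin' y (hPQ hy))
    obtain ⟨y₀, hy₀⟩ := hne
    have hue : u i = a i x := le_antisymm hcase ((hxe y₀ hy₀) ▸ hy₀ i)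
    have hPs : P = polyhedronSlice a i (a i x) v := by
      rw [hPeq]
      ext y
      refine ⟨fun hy => ⟨hy.1, le_antisymm (hue ▸ hy.2) (hmin' y hy.1)⟩, fun hy => ⟨hy.1, ?_⟩⟩
      exact (hy.2.trans hue.symm).le
    have hPavg : affineAverage P f = c := by rw [hPs]
    rw [hPavg, abs_sub_comm, hQavg, abs_mul, abs_of_pos (inv_pos.2 hVpos), inv_mul_le_iff₀ hVpos]
    refine hIQ.trans ?_
    rw [hue, mul_comm (μ.real Q)]
    refine mul_le_mul_of_nonneg_right ?_ hVpos.le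
    have h1 : 0 ≤ v i - a i x := hue ▸ hs0
    have h2 : 0 ≤ C * (2 * Module.finrank ℝ E) * (v i - a i x) := by positivity
    linarith
  · have hl : 0 < v i - a i x := by linarith
    set r := (v i - u i) / (v i - a i x) with hr
    have hr0 : 0 ≤ r := div_nonneg hs0 hl.le
    have hr1 : r < 1 := (div_lt_one hl).2 (by linarith)
    have hrl : r * (v i - a i x) = v i - u i := div_mul_cancel₀ _ hl.ne'
    have hvol := measureReal_polyhedron_le hb huv' hx hr0 hr1.le hrl.ge
    rw [← hQ, ← hP, ← hμ] at hvol
    have hUpos : 0 < μ.real P :=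
      (mul_pos (pow_pos (sub_pos.2 hr1) _) hVpos).trans_le hvol
    -- Bernoulli's inequality makes the volume loss linear in `r`.
    have hber : 1 - Module.finrank ℝ E * r ≤ (1 - r) ^ Module.finrank ℝ E := by
      have := one_add_mul_le_pow (a := -r) (by linarith) (Module.finrank ℝ E)
      rw [← sub_eq_add_neg] at this
      linarith
    have hvol' : μ.real Q - μ.real P ≤ Module.finrank ℝ E * r * μ.real Q := by
      have := mul_le_mul_of_nonneg_right hber hVpos.le
      linarith
    have hPavg := affineAverage_sub_eq hPc (fun h => by simp [μ, measureReal_def, h] at hUpos)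
      hf.continuous c
    rw [← hμ] at hPavg
    have hsplit : ∫ y in Q, (f y - c) ∂μ =
        (∫ y in P, (f y - c) ∂μ) + ∫ y in Q \ P, (f y - c) ∂μ := by
      have hgi : IntegrableOn (fun y => f y - c) Q μ :=
        (hf.continuous.sub continuous_const).continuousOn.integrableOn_compact hQc
      rw [← setIntegral_union Set.disjoint_sdiff_right (hQc.measurableSet.diff hPc.measurableSet)
        (hgi.mono_set hPQ) (hgi.mono_set Set.sdiff_subset), Set.union_sdiff_cancel hPQ]
    have hD : μ.real (Q \ P) = μ.real Q - μ.real P :=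
      measureReal_sdiff hPQ hPc.measurableSet hQc.measure_lt_top.ne
    rw [hD] at hID
    have hUV : μ.real P ≤ μ.real Q := measureReal_mono hPQ hQc.measure_lt_top.ne
    set U := μ.real P
    set V := μ.real Q
    set IP := ∫ y in P, (f y - c) ∂μ
    set ID := ∫ y in Q \ P, (f y - c) ∂μ
    have hM : 0 ≤ C * (v i - a i x) := by positivity
    -- Both terms on the right are bounded by `C * (v i - a i x) * (V - U)`, which is where the
    -- factor 2 in the constant comes from.
    have e1 : affineAverage P f - affineAverage Q f = ((V - U) / U * IP - ID) / V := by
      rw [← sub_sub_sub_cancel_right _ _ c, hPavg, hQavg, hsplit]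
      field_simp
      ring
    rw [e1, abs_div, abs_of_pos hVpos, div_le_iff₀ hVpos]
    have e2 : |(V - U) / U * IP| ≤ C * (v i - a i x) * (V - U) := by
      rw [abs_mul, abs_of_nonneg (div_nonneg (sub_nonneg.2 hUV) hUpos.le), div_mul_eq_mul_div,
        div_le_iff₀ hUpos]
      have := mul_le_mul_of_nonneg_left hIP (sub_nonneg.2 hUV)
      linarith
    have e3 := abs_sub ((V - U) / U * IP) ID
    have e4 := mul_le_mul_of_nonneg_left hvol' hM
    have e5 : C * (v i - a i x) * (Module.finrank ℝ E * r * V) =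
        C * Module.finrank ℝ E * (v i - u i) * V := by rw [← hrl]; ring
    have e6 : 0 ≤ C * (v i - u i) * V := by positivity
    linarith

end AverageLipschitz

/-! ### Induction on the dimension: Lipschitz averages and Hoffman's bound -/

section MainInduction

universe v

variable {E : Type v} [NormedAddCommGroup E] [InnerProductSpace ℝ E] {ι : Type*}

theorem finrank_ker_lt [FiniteDimensional ℝ E] {a : E →L[ℝ] ℝ} (ha : a ≠ 0) :
    Module.finrank ℝ (LinearMap.ker a.toLinearMap) < Module.finrank ℝ E := by
  refine Submodule.finrank_lt fun h => ha ?_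
  ext y
  exact LinearMap.mem_ker.1 (h ▸ Submodule.mem_top : y ∈ LinearMap.ker a.toLinearMap)

variable [Fintype ι]

theorem dist_sup_le (u v : ι → ℝ) : dist u (u ⊔ v) ≤ dist u v := by
  refine (dist_pi_le_iff dist_nonneg).2 fun i => ?_
  rcases le_total (u i) (v i) with h | h
  · simpa [h] using dist_le_pi_dist u v i
  · simp [h]

theorem sub_le_dist_pi (u v : ι → ℝ) (i : ι) : v i - u i ≤ dist u v := by
  refine (le_abs_self _).trans ?_
  rw [← Real.dist_eq, dist_comm]
  exact dist_le_pi_dist u v i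

theorem AverageLipschitz.of_slices [MeasurableSpace E] [BorelSpace E] [FiniteDimensional ℝ E]
    {a : ι → E →L[ℝ] ℝ} (hb : ∀ u, Bornology.IsBounded (polyhedron a u)) {C : ℝ} (hC : 0 ≤ C)
    (hS : ∀ j, a j ≠ 0 → SliceAverageLipschitz a j C) :
    ∃ C', 0 ≤ C' ∧ AverageLipschitz a C' := by
  set K := C * (2 * Module.finrank ℝ E + 1) with hK
  have hK0 : 0 ≤ K := by positivity
  have hCK : C ≤ K := by
    have : 0 ≤ C * (2 * Module.finrank ℝ E) := by positivity
    linarith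
  have hstep : ∀ u v : ι → ℝ, (polyhedron a u).Nonempty → u ≤ v → (∃ i, ∀ j, j ≠ i → v j = u j) →
      ∀ f : E → ℝ, LipschitzWith 1 f →
      |affineAverage (polyhedron a u) f - affineAverage (polyhedron a v) f| ≤ K * dist u v := by
    rintro u v hne huv ⟨i, hi⟩ f hf
    have hne' := hne.mono (polyhedron_mono a huv)
    by_cases hai : a i = 0
    · have : polyhedron a u = polyhedron a v := by
        refine (polyhedron_mono a huv).antisymm fun y hy j => ?_
        by_cases hj : j = i
        · obtain ⟨y₀, hy₀⟩ := hne
          have := hy₀ j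
          rw [hj, hai] at this ⊢
          exact this
        · exact hi j hj ▸ hy j
      rw [this, sub_self, abs_zero]
      positivity
    rcases interior_polyhedron_nonempty_or a v hne' with hint | ⟨j, hj, hconst⟩
    · exact (abs_affineAverage_sub_le_of_interior hb hC hai (hS i hai) huv hi hne hint hf).trans
        (mul_le_mul_of_nonneg_left (sub_le_dist_pi u v i) hK0)
    -- An implicit equality on the larger polyhedron holds on the smaller one, so both are slices at
    -- the same level `v j`.
    · have h1 : ∀ w : ι → ℝ, w ≤ v → polyhedron a w = polyhedronSlice a j (v j) w := fun w hw =>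
        Set.ext fun y => ⟨fun hy => ⟨hy, hconst y (polyhedron_mono a hw hy)⟩, fun hy => hy.1⟩
      have h2 := hS j hj (v j) (v j) u v (h1 u huv ▸ hne) (h1 v le_rfl ▸ hne') f hf
      rw [← h1 u huv, ← h1 v le_rfl, sub_self, abs_zero, zero_add] at h2
      exact h2.trans (mul_le_mul_of_nonneg_right hCK dist_nonneg)
  have hmono : ∀ u v : ι → ℝ, (polyhedron a u).Nonempty → u ≤ v → ∀ f : E → ℝ, LipschitzWith 1 f →
      |affineAverage (polyhedron a u) f - affineAverage (polyhedron a v) f| ≤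
        Fintype.card ι * (K * dist u v) := by
    intro u v hne huv f hf
    refine le_card_mul_of_le_update (R := fun u v e =>
      |affineAverage (polyhedron a u) f - affineAverage (polyhedron a v) f| ≤ e) huv (by simp) ?_
    intro w x e huw hwx _ hd hi he
    refine (abs_sub_le _ (affineAverage (polyhedron a w) f) _).trans (add_le_add he ?_)
    exact (hstep w x (hne.mono (polyhedron_mono a huw)) hwx hi f hf).trans
      (mul_le_mul_of_nonneg_left hd hK0)
  -- Passing through `u ⊔ v` only raises bounds, so every intermediate polyhedron stays nonempty.
  refine ⟨2 * (Fintype.card ι * K), by positivity, fun u v hu hv f hf => ?_⟩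
  have h1 := hmono u (u ⊔ v) hu le_sup_left f hf
  have h2 := hmono v (u ⊔ v) hv le_sup_right f hf
  have h3 := abs_sub_le (affineAverage (polyhedron a u) f)
    (affineAverage (polyhedron a (u ⊔ v)) f) (affineAverage (polyhedron a v) f)
  rw [abs_sub_comm] at h2
  have hcK : 0 ≤ Fintype.card ι * K := by positivity
  have h4 := mul_le_mul_of_nonneg_left (dist_sup_le u v) hcK
  have h5 := mul_le_mul_of_nonneg_left (dist_sup_le v u) hcK
  rw [sup_comm, dist_comm v u] at h5
  linarith

/-- Averages of `1`-Lipschitz functions over bounded polyhedra with fixed normals are Lipschitz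
functions of the right hand side. -/
theorem exists_averageLipschitz [MeasurableSpace E] [BorelSpace E] [FiniteDimensional ℝ E]
    {a : ι → E →L[ℝ] ℝ} (hb : ∀ u, Bornology.IsBounded (polyhedron a u)) :
    ∃ C, 0 ≤ C ∧ AverageLipschitz a C := by
  induction hd : Module.finrank ℝ E using Nat.strong_induction_on generalizing E with
  | _ d ih =>
    have hex : ∀ j, ∃ C, 0 ≤ C ∧ (a j ≠ 0 → SliceAverageLipschitz a j C) := by
      intro j
      by_cases hj : a j = 0
      · exact ⟨0, le_rfl, fun h => absurd hj h⟩
      obtain ⟨C, hC, h⟩ := ih _ (hd ▸ finrank_ker_lt hj)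
        (isBounded_polyhedron_kerRestrict hb j) rfl
      obtain ⟨C', hC', h'⟩ := h.slice hb hj hC
      exact ⟨C', hC', fun _ => h'⟩
    choose C hC hS using hex
    refine AverageLipschitz.of_slices hb (Finset.sum_nonneg (s := Finset.univ) fun j _ => hC j)
      fun j hj t t' u u' hne hne' f hf => (hS j hj t t' u u' hne hne' f hf).trans ?_
    exact mul_le_mul_of_nonneg_right
      (Finset.single_le_sum (fun j _ => hC j) (Finset.mem_univ j)) (by positivity)

/-- Hoffman's error bound: the polyhedra with normals `a` depend on the right hand sides in a
Lipschitz way, with constant `C`, for the Hausdorff distance. -/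
def HoffmanBound (a : ι → E →L[ℝ] ℝ) (C : ℝ) : Prop :=
  ∀ u v, (polyhedron a v).Nonempty → ∀ y ∈ polyhedron a u, ∃ z ∈ polyhedron a v,
    dist y z ≤ C * dist u v

/-- The point y violates only constraint i. The segment from a feasible point to y meets the
hyperplane a_i = v_i, so that slice is nonempty, and the bound in the kernel moves y from its own
slice into it. -/
theorem HoffmanBound.of_kerRestrict {a : ι → E →L[ℝ] ℝ} {i : ι} (hi : a i ≠ 0) {C : ℝ}
    (hC : 0 ≤ C) (h : HoffmanBound (kerRestrict a i) C) :
    ∃ C', 0 ≤ C' ∧ ∀ u v : ι → ℝ, (∀ j, j ≠ i → v j = u j) → (polyhedron a v).Nonempty →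
      ∀ y ∈ polyhedron a u, v i < a i y → ∃ z ∈ polyhedron a v, dist y z ≤ C' * dist v u := by
  obtain ⟨w, hw⟩ := exists_map_eq_one hi
  set N := ‖fun i => a i w‖
  have hN : 0 ≤ N := norm_nonneg _
  refine ⟨C * N + ‖w‖, by positivity, fun u v huv ⟨x, hx⟩ y hy hyi => ?_⟩
  have hvu : v ≤ u := fun j => by
    by_cases hj : j = i
    · exact hj ▸ (hyi.trans_le (hy i)).le
    · exact (huv j hj).le
  have hslice : polyhedronSlice a i (v i) u ⊆ polyhedron a v := fun z hz j => by
    by_cases hj : j = i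
    · exact hj ▸ hz.2.le
    · exact huv j hj ▸ hz.1 j
  have hne : (polyhedronSlice a i (v i) u).Nonempty := by
    have hlt : 0 < a i y - a i x := by linarith [hx i]
    set l := (v i - a i x) / (a i y - a i x) with hl
    have hl0 : 0 ≤ l := div_nonneg (by linarith [hx i]) hlt.le
    have hl1 : l ≤ 1 := (div_le_one hlt).2 (by linarith)
    have hle : l * (a i y - a i x) = v i - a i x := div_mul_cancel₀ _ hlt.ne'
    refine ⟨(1 - l) • x + l • y, convex_polyhedron a u (polyhedron_mono a hvu hx) hy
      (sub_nonneg.2 hl1) hl0 (by ring), ?_⟩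
    simp only [map_add, map_smul, smul_eq_mul]
    linarith
  have hyS : y ∈ polyhedronSlice a i (a i y) u := ⟨hy, rfl⟩
  rw [polyhedronSlice_eq_image a hw] at hne hyS hslice
  rw [Set.image_nonempty] at hne
  obtain ⟨y', hy', hyy'⟩ := hyS
  obtain ⟨z', hz', hd⟩ := h _ _ hne y' hy'
  refine ⟨sliceMap (a i) w (v i) z', hslice ⟨z', hz', rfl⟩, ?_⟩
  have h1 := mul_le_mul_of_nonneg_left (dist_slice_parameters_le a w (a i y) (v i) u u) hC
  rw [dist_self, zero_add] at h1
  have h2 : dist y (sliceMap (a i) w (v i) z') ≤ dist y' z' + |a i y - v i| * ‖w‖ := by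
    have he : dist y (sliceMap (a i) w (v i) z') = ‖((y' : E) + a i y • w) - (z' + v i • w)‖ := by
      rw [dist_eq_norm]
      exact congrArg (fun q => ‖q - sliceMap (a i) w (v i) z'‖) hyy'.symm
    rw [he, add_sub_add_comm, ← sub_smul]
    refine (norm_add_le _ _).trans ?_
    rw [norm_smul, Real.norm_eq_abs, Subtype.dist_eq, dist_eq_norm]
  have h3 : |a i y - v i| ≤ dist v u := by
    rw [abs_of_pos (sub_pos.2 hyi)]
    exact (sub_le_sub_right (hy i) _).trans (sub_le_dist_pi v u i)
  have h4 := mul_le_mul_of_nonneg_right h3 (by positivity : 0 ≤ C * N + ‖w‖)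
  change _ ≤ C * (|a i y - v i| * N) at h1
  linarith

theorem exists_hoffmanBound [FiniteDimensional ℝ E] (a : ι → E →L[ℝ] ℝ) :
    ∃ C, 0 ≤ C ∧ HoffmanBound a C := by
  induction hd : Module.finrank ℝ E using Nat.strong_induction_on generalizing E with
  | _ d ih =>
    have hex : ∀ i, ∃ C, 0 ≤ C ∧ (∀ u v : ι → ℝ, (∀ j, j ≠ i → v j = u j) →
        (polyhedron a v).Nonempty → ∀ y ∈ polyhedron a u, v i < a i y →
          ∃ z ∈ polyhedron a v, dist y z ≤ C * dist v u) := by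
      intro i
      by_cases hi : a i = 0
      · refine ⟨0, le_rfl, fun u v _ ⟨x, hx⟩ y _ hyi => absurd (hx i) ?_⟩
        rw [hi] at hyi ⊢
        exact not_le.2 hyi
      obtain ⟨C, hC, h⟩ := ih _ (hd ▸ finrank_ker_lt hi) (kerRestrict a i) rfl
      exact h.of_kerRestrict hi hC
    choose C hC hS using hex
    have hsum : 0 ≤ ∑ i, C i := Finset.sum_nonneg fun i _ => hC i
    refine ⟨Fintype.card ι * ∑ i, C i, by positivity, fun u v hne y hy => ?_⟩
    -- Starting from the larger polyhedron of `v ⊔ u`, bounds are lowered one at a time; each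
    -- containing the polyhedron of `v`, none is empty.
    have hmain : ∀ y ∈ polyhedron a (v ⊔ u), ∃ z ∈ polyhedron a v,
        dist y z ≤ Fintype.card ι * ((∑ i, C i) * dist v (v ⊔ u)) := by
      refine le_card_mul_of_le_update (R := fun v w e => ∀ y ∈ polyhedron a w,
        ∃ z ∈ polyhedron a v, dist y z ≤ e) le_sup_left (fun y hy => ⟨y, hy, by simp⟩) ?_
      rintro w x e hvw hwx - hd ⟨i, hi⟩ he y hy
      have : ∃ y' ∈ polyhedron a w, dist y y' ≤ (∑ i, C i) * dist v (v ⊔ u) := by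
        rcases lt_or_ge (w i) (a i y) with hlt | hge
        · obtain ⟨y', hy', hd'⟩ := hS i x w (fun j hj => (hi j hj).symm)
            (hne.mono (polyhedron_mono a hvw)) y hy hlt
          refine ⟨y', hy', hd'.trans (mul_le_mul ?_ hd dist_nonneg hsum)⟩
          exact Finset.single_le_sum (fun j _ => hC j) (Finset.mem_univ i)
        · refine ⟨y, fun j => ?_, by rw [dist_self]; positivity⟩
          by_cases hj : j = i
          · exact hj ▸ hge
          · exact hi j hj ▸ hy j
      obtain ⟨y', hy', hd'⟩ := this
      obtain ⟨z, hz, hd''⟩ := he y' hy'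
      exact ⟨z, hz, (dist_triangle _ _ _).trans (by linarith)⟩
    obtain ⟨z, hz, hd⟩ := hmain y (polyhedron_mono a le_sup_right hy)
    refine ⟨z, hz, hd.trans ?_⟩
    rw [mul_assoc, dist_comm u v]
    gcongr
    exact dist_sup_le v u

end MainInduction

/-! ### Minimizers of a linear functional -/

section Argmin

variable {E : Type*} [NormedAddCommGroup E] [InnerProductSpace ℝ E] [FiniteDimensional ℝ E]
  {ι : Type*} [Fintype ι]

/-- The minimizers of the linear functional `c` over a polyhedron. -/
def polyhedronArgmin (a : ι → E →L[ℝ] ℝ) (c : E →L[ℝ] ℝ) (u : ι → ℝ) : Set E :=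
  {y ∈ polyhedron a u | ∀ z ∈ polyhedron a u, c y ≤ c z}

omit [FiniteDimensional ℝ E] [Fintype ι] in
theorem polyhedronArgmin_eq {a : ι → E →L[ℝ] ℝ} {c : E →L[ℝ] ℝ} {u : ι → ℝ} {y : E}
    (hy : y ∈ polyhedronArgmin a c u) : polyhedronArgmin a c u =
      polyhedron (fun k : Option ι => k.elim c a) (fun k => k.elim (c y) u) := by
  ext z
  simp only [polyhedron, Set.mem_ofPred_eq, Option.forall, Option.elim_none, Option.elim_some]
  exact ⟨fun hz => ⟨hz.2 y hy.1, hz.1⟩, fun hz => ⟨hz.2, fun x hx => hz.1.trans (hy.2 x hx)⟩⟩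

omit [Fintype ι] in
theorem polyhedronArgmin_nonempty {a : ι → E →L[ℝ] ℝ} (c : E →L[ℝ] ℝ) {u : ι → ℝ}
    (hb : Bornology.IsBounded (polyhedron a u)) (hne : (polyhedron a u).Nonempty) :
    (polyhedronArgmin a c u).Nonempty := by
  obtain ⟨y, hy, hmin⟩ := (Metric.isCompact_of_isClosed_isBounded
    (isClosed_polyhedron a u) hb).exists_isMinOn hne c.continuous.continuousOn
  exact ⟨y, hy, fun z hz => hmin hz⟩

/-- Hoffman's bound gives, near a minimizer for one right-hand side, a feasible point for the other,
whose cost bounds the other minimum from above. -/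
theorem exists_minimum_lipschitz (a : ι → E →L[ℝ] ℝ) (c : E →L[ℝ] ℝ) :
    ∃ C, 0 ≤ C ∧ ∀ u v, ∀ y ∈ polyhedronArgmin a c u, ∀ z ∈ polyhedronArgmin a c v,
      |c y - c z| ≤ C * dist u v := by
  obtain ⟨C, hC, h⟩ := exists_hoffmanBound a
  refine ⟨‖c‖ * C, by positivity, ?_⟩
  have key : ∀ u v, ∀ y ∈ polyhedronArgmin a c u, ∀ z ∈ polyhedronArgmin a c v,
      c y - c z ≤ ‖c‖ * C * dist u v := by
    intro u v y hy z hz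
    obtain ⟨x, hx, hd⟩ := h v u ⟨y, hy.1⟩ z hz.1
    have h1 := hy.2 x hx
    have h2 : c x - c z ≤ ‖c‖ * dist z x := by
      rw [← map_sub, dist_comm, dist_eq_norm]
      exact (le_abs_self _).trans (c.le_opNorm _)
    have h3 := mul_le_mul_of_nonneg_left hd (norm_nonneg c)
    rw [dist_comm v u] at h3
    linarith
  intro u v y hy z hz
  refine abs_le.2 ⟨?_, key u v y hy z hz⟩
  have := key v u z hz y hy
  rw [dist_comm] at this
  linarith

theorem exists_average_argmin_lipschitz [MeasurableSpace E] [BorelSpace E]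
    {a : ι → E →L[ℝ] ℝ} (hb : ∀ u, Bornology.IsBounded (polyhedron a u)) (c : E →L[ℝ] ℝ) :
    ∃ C, 0 ≤ C ∧ ∀ u v, (polyhedron a u).Nonempty → (polyhedron a v).Nonempty →
      ∀ f : E → ℝ, LipschitzWith 1 f →
      |affineAverage (polyhedronArgmin a c u) f - affineAverage (polyhedronArgmin a c v) f| ≤
        C * dist u v := by
  -- The objective is the extra normal `none`; the original constraints alone already give
  -- boundedness.
  obtain ⟨C, hC, h⟩ := exists_averageLipschitz (a := fun k : Option ι => k.elim c a) fun u =>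
    (hb fun i => u (some i)).subset fun y hy i => hy (some i)
  obtain ⟨K, hK, hmin⟩ := exists_minimum_lipschitz a c
  refine ⟨C * (K + 1), by positivity, fun u v hu hv f hf => ?_⟩
  obtain ⟨y, hy⟩ := polyhedronArgmin_nonempty c (hb u) hu
  obtain ⟨z, hz⟩ := polyhedronArgmin_nonempty c (hb v) hv
  have h1 := h (fun k => k.elim (c y) u) (fun k => k.elim (c z) v) (polyhedronArgmin_eq hy ▸ ⟨y, hy⟩)
    (polyhedronArgmin_eq hz ▸ ⟨z, hz⟩) f hf
  rw [← polyhedronArgmin_eq hy, ← polyhedronArgmin_eq hz] at h1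
  refine h1.trans ?_
  rw [mul_assoc]
  refine mul_le_mul_of_nonneg_left ?_ hC
  refine (dist_pi_le_iff (by positivity)).2 fun k => ?_
  have hd : 0 ≤ dist u v := dist_nonneg
  cases k with
  | none =>
    have := hmin u v y hy z hz
    simp only [Option.elim_none, Real.dist_eq]
    linarith
  | some i =>
    have := dist_le_pi_dist u v i
    have h2 : 0 ≤ K * dist u v := by positivity
    simp only [Option.elim_some]
    linarith

end Argmin

/-! ### Neutral beliefs as affine averages -/

section NeutralBelief

variable {n m p : ℕ}

theorem affineLebesgue_apply_self {s : Set (EuclideanSpace ℝ (Fin m))} :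
    affineLebesgue s s = μHE[affineDim s] s := by
  rw [affineLebesgue, Measure.restrict_eq_self _ (subset_affineSpan ℝ s)]
  rfl

theorem cond_affineLebesgue {s : Set (EuclideanSpace ℝ (Fin m))} (hs : MeasurableSet s) :
    ProbabilityTheory.cond (affineLebesgue s) s =
      (μHE[affineDim s] s)⁻¹ • (μHE[affineDim s] : Measure _).restrict s := by
  rw [ProbabilityTheory.cond, affineLebesgue_apply_self, affineLebesgue,
    Measure.restrict_restrict hs, Set.inter_eq_left.2 (subset_affineSpan ℝ s)]
  rfl

theorem integral_cond_affineLebesgue {s : Set (EuclideanSpace ℝ (Fin m))} (hs : MeasurableSet s)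
    (f : EuclideanSpace ℝ (Fin m) → ℝ) :
    ∫ y, f y ∂ProbabilityTheory.cond (affineLebesgue s) s = affineAverage s f := by
  rw [cond_affineLebesgue hs, affineAverage, average_eq', Measure.restrict_apply_univ]

variable {X : Type*} {Y : Set (EuclideanSpace ℝ (Fin m))}

theorem isBelief_neutralBelief {S : X → Set Y} (hY : MeasurableSet Y)
    (hconv : ∀ x, Convex ℝ (Subtype.val '' S x)) (hcomp : ∀ x, IsCompact (Subtype.val '' S x))
    (hne : ∀ x, (S x).Nonempty) : IsBelief S (neutralBelief S) := by
  intro x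
  obtain ⟨h0, h1⟩ := measure_affineDim_pos_lt_top (hconv x) (hcomp x) ((hne x).image _)
  rw [← affineLebesgue_apply_self] at h0 h1
  have hprob := ProbabilityTheory.cond_isProbabilityMeasure_of_finite h0.ne' h1.ne
  have hself : ProbabilityTheory.cond (affineLebesgue (Subtype.val '' S x)) (Subtype.val '' S x)
      (Subtype.val '' S x) = 1 := ProbabilityTheory.cond_apply_self h0.ne' h1.ne
  have happ : ∀ T : Set Y, neutralBelief S x T =
      ProbabilityTheory.cond (affineLebesgue (Subtype.val '' S x)) (Subtype.val '' S x)
        (Subtype.val '' T) := fun T => (MeasurableEmbedding.subtype_coe hY).comap_apply _ T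
  refine ⟨⟨le_antisymm ?_ ?_⟩, ?_⟩
  · rw [happ]
    exact prob_le_one
  · rw [happ, ← hself]
    exact measure_mono (Set.image_mono (Set.subset_univ _))
  · rw [happ, hself]

theorem integral_neutralBelief {S : X → Set Y} (hY : MeasurableSet Y) (x : X)
    (hS : MeasurableSet (Subtype.val '' S x)) (f : EuclideanSpace ℝ (Fin m) → ℝ) :
    ∫ y : Y, f y ∂neutralBelief S x = affineAverage (Subtype.val '' S x) f := by
  rw [neutralBelief, integral_subtype_comap hY, ← integral_cond_affineLebesgue hS,
    cond_affineLebesgue hS, Measure.restrict_smul, Measure.restrict_restrict hY,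
    Set.inter_eq_right.2 (Subtype.coe_image_subset Y (S x))]

theorem wasserstein1_neutralBelief_le {S : X → Set Y} (hY : MeasurableSet Y)
    (hS : ∀ x, MeasurableSet (Subtype.val '' S x)) {x x' : X} {D : ℝ}
    (h : ∀ f : EuclideanSpace ℝ (Fin m) → ℝ, LipschitzWith 1 f →
      |affineAverage (Subtype.val '' S x) f - affineAverage (Subtype.val '' S x') f| ≤ D) :
    wasserstein1 (neutralBelief S x) (neutralBelief S x') ≤ ENNReal.ofReal D := by
  refine iSup₂_le fun f hf => ENNReal.ofReal_le_ofReal ?_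
  -- A test function on `Y` extends to the whole space with the same Lipschitz constant.
  obtain ⟨g, hg, hfg⟩ : ∃ g : EuclideanSpace ℝ (Fin m) → ℝ, LipschitzWith 1 g ∧
      ∀ y : Y, f y = g y := by
    have hon : LipschitzOnWith 1 (Function.extend Subtype.val f 0) Y := by
      rw [lipschitzOnWith_iff_restrict]
      convert hf using 1
      ext y
      exact Subtype.val_injective.extend_apply f 0 y
    obtain ⟨g, hg, hfg⟩ := hon.extend_real
    exact ⟨g, hg, fun y => by rw [← hfg y.2, Subtype.val_injective.extend_apply]⟩
  simp only [hfg]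
  rw [integral_neutralBelief hY x (hS x), integral_neutralBelief hY x' (hS x')]
  exact (le_abs_self _).trans (h g hg)

end NeutralBelief

/-! ### The solution map as the argmin over a boxed polyhedron -/

section SolutionMap

variable {n m p : ℕ} (A : Matrix (Fin p) (Fin n) ℝ) (B : Matrix (Fin p) (Fin m) ℝ)
  (b : Fin p → ℝ) (c : Fin m → ℝ)

/-- Multiplication by a matrix, as a continuous linear map on Euclidean space. -/
noncomputable def mulVecCLM (A : Matrix (Fin p) (Fin n) ℝ) :
    EuclideanSpace ℝ (Fin n) →L[ℝ] (Fin p → ℝ) :=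
  LinearMap.toContinuousLinearMap
    (A.mulVecLin ∘ₗ (WithLp.linearEquiv 2 ℝ (Fin n → ℝ)).toLinearMap)

/-- The objective `y ↦ cᵀ y` as a continuous linear functional. -/
noncomputable def objective : EuclideanSpace ℝ (Fin m) →L[ℝ] ℝ :=
  LinearMap.toContinuousLinearMap
    (dotProductBilin ℝ ℝ c ∘ₗ (WithLp.linearEquiv 2 ℝ (Fin m → ℝ)).toLinearMap)

/-- The rows of `B` and the coordinate functionals with both signs. -/
noncomputable def boxedRows : Fin p ⊕ (Fin m ⊕ Fin m) → EuclideanSpace ℝ (Fin m) →L[ℝ] ℝ :=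
  Sum.elim (fun i => (ContinuousLinearMap.proj i).comp (mulVecCLM B))
    (Sum.elim (fun j => EuclideanSpace.proj j) (fun j => -EuclideanSpace.proj j))

/-- The right hand sides `b - A x` together with the bounds `R` on the coordinates. -/
noncomputable def boxedRhs (R : ℝ) (x : EuclideanSpace ℝ (Fin n)) : Fin p ⊕ (Fin m ⊕ Fin m) → ℝ :=
  Sum.elim (fun i => b i - (A *ᵥ x.ofLp) i) fun _ => R

/-- The box constraints supply boundedness for every right-hand side, as the induction requires. -/
theorem isBounded_polyhedron_boxedRows (u : Fin p ⊕ (Fin m ⊕ Fin m) → ℝ) :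
    Bornology.IsBounded (polyhedron (boxedRows B) u) := by
  have h : Bornology.IsBounded (Set.univ.pi fun j : Fin m =>
      Set.Icc (-u (Sum.inr (Sum.inr j))) (u (Sum.inr (Sum.inl j)))) :=
    Bornology.IsBounded.pi fun j => Metric.isBounded_Icc _ _
  refine ((PiLp.antilipschitzWith_ofLp 2 fun _ : Fin m => ℝ).isBounded_preimage h).subset ?_
  intro y hy j _
  have h1 := hy (Sum.inr (Sum.inl j))
  have h2 := hy (Sum.inr (Sum.inr j))
  exact ⟨neg_le.1 h2, h1⟩

variable {A B b}

/-- Coordinates are bounded by the norm, hence by R on Y, so the box cuts nothing off. -/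
theorem mem_polyhedron_boxedRows {R : ℝ} (hR : ∀ y ∈ projY A B b, ‖y‖ ≤ R)
    (x : EuclideanSpace ℝ (Fin n)) (y : EuclideanSpace ℝ (Fin m)) :
    y ∈ polyhedron (boxedRows B) (boxedRhs A b R x) ↔ (x, y) ∈ feasibleSet A B b := by
  have hrow : (∀ i, boxedRows B (Sum.inl i) y ≤ boxedRhs (m := m) A b R x (Sum.inl i)) ↔
      (x, y) ∈ feasibleSet A B b :=
    forall_congr' fun i => by
      simp only [boxedRows, boxedRhs, Sum.elim_inl, Pi.add_apply]
      exact le_sub_iff_add_le'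
  refine ⟨fun hy => hrow.1 fun i => hy (Sum.inl i), fun hy => ?_⟩
  have hj : ∀ j, |y j| ≤ R := fun j => (PiLp.norm_apply_le y j).trans (hR y ⟨x, hy⟩)
  rintro (i | j | j)
  · exact hrow.2 hy i
  · exact (abs_le.1 (hj j)).2
  · exact neg_le.1 (abs_le.1 (hj j)).1

theorem image_solutionMap {R : ℝ} (hR : ∀ y ∈ projY A B b, ‖y‖ ≤ R) (x : projX A B b) :
    Subtype.val '' solutionMap A B b c x =
      polyhedronArgmin (boxedRows B) (objective c) (boxedRhs A b R x) := by
  ext y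
  constructor
  · rintro ⟨y, hy, rfl⟩
    exact ⟨(mem_polyhedron_boxedRows hR _ _).2 hy.1,
      fun z hz => hy.2 z ((mem_polyhedron_boxedRows hR _ _).1 hz)⟩
  · rintro ⟨hy, hmin⟩
    rw [mem_polyhedron_boxedRows hR] at hy
    exact ⟨⟨y, x, hy⟩, ⟨hy, fun z hz => hmin z ((mem_polyhedron_boxedRows hR _ _).2 hz)⟩, rfl⟩

theorem dist_boxedRhs_le (A : Matrix (Fin p) (Fin n) ℝ) (b : Fin p → ℝ) (R : ℝ)
    (x x' : EuclideanSpace ℝ (Fin n)) :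
    dist (boxedRhs (m := m) A b R x) (boxedRhs A b R x') ≤ ‖mulVecCLM A‖ * dist x x' := by
  refine (dist_pi_le_iff (by positivity)).2 ?_
  rintro (i | j)
  · simp only [boxedRhs, Sum.elim_inl]
    rw [dist_sub_left]
    refine (dist_le_pi_dist (mulVecCLM A x) (mulVecCLM A x') i).trans ?_
    rw [dist_eq_norm, ← map_sub, dist_eq_norm]
    exact (mulVecCLM A).le_opNorm _
  · simp only [boxedRhs, Sum.elim_inr, dist_self]
    positivity

theorem isCompact_feasibleSet (hbd : Bornology.IsBounded (feasibleSet A B b)) :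
    IsCompact (feasibleSet A B b) := by
  refine Metric.isCompact_of_isClosed_isBounded ?_ hbd
  exact isClosed_le (((mulVecCLM A).continuous.comp continuous_fst).add
    ((mulVecCLM B).continuous.comp continuous_snd)) continuous_const

theorem isCompact_projY (hbd : Bornology.IsBounded (feasibleSet A B b)) :
    IsCompact (projY A B b) := by
  have h : projY A B b = Prod.snd '' feasibleSet A B b := by
    ext y
    exact ⟨fun ⟨x, hx⟩ => ⟨(x, y), hx, rfl⟩, fun ⟨⟨x, _⟩, hx, hy⟩ => ⟨x, hy ▸ hx⟩⟩
  rw [h]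
  exact (isCompact_feasibleSet hbd).image continuous_snd

end SolutionMap

theorem mainTheorem5 (n m p : ℕ) (A : Matrix (Fin p) (Fin n) ℝ) (B : Matrix (Fin p) (Fin m) ℝ)
    (b : Fin p → ℝ) (c : Fin m → ℝ) (hne : (feasibleSet A B b).Nonempty)
    (hbd : Bornology.IsBounded (feasibleSet A B b)) :
    IsBelief (solutionMap A B b c) (neutralBelief (solutionMap A B b c)) ∧
      ∃ L : ℝ≥0, ∀ x x' : projX A B b,
        wasserstein1 (neutralBelief (solutionMap A B b c) x)
          (neutralBelief (solutionMap A B b c) x') ≤ L * edist x x' := by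
  have hY := isCompact_projY hbd
  obtain ⟨R, hR⟩ := hY.isBounded.exists_norm_le
  have hb := isBounded_polyhedron_boxedRows B
  have hfeas : ∀ x : projX A B b,
      (polyhedron (boxedRows B) (boxedRhs A b R x.1)).Nonempty := fun x =>
    x.2.imp fun y hy => (mem_polyhedron_boxedRows hR _ _).2 hy
  have hargmin : ∀ x : projX A B b, (Subtype.val '' solutionMap A B b c x).Nonempty ∧
      Convex ℝ (Subtype.val '' solutionMap A B b c x) ∧
      IsCompact (Subtype.val '' solutionMap A B b c x) := by
    intro x
    rw [image_solutionMap c hR]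
    obtain ⟨y, hy⟩ := polyhedronArgmin_nonempty (objective c) (hb _) (hfeas x)
    refine ⟨⟨y, hy⟩, ?_, Metric.isCompact_of_isClosed_isBounded ?_
      ((hb (boxedRhs A b R x.1)).subset fun z hz => hz.1)⟩
    · rw [polyhedronArgmin_eq hy]
      exact convex_polyhedron _ _
    · rw [polyhedronArgmin_eq hy]
      exact isClosed_polyhedron _ _
  refine ⟨isBelief_neutralBelief hY.measurableSet (fun x => (hargmin x).2.1)
    (fun x => (hargmin x).2.2) fun x => Set.image_nonempty.1 (hargmin x).1, ?_⟩
  obtain ⟨C, hC, h⟩ := exists_average_argmin_lipschitz hb (objective c)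
  refine ⟨⟨C * ‖mulVecCLM A‖, by positivity⟩, fun x x' => ?_⟩
  have hW := wasserstein1_neutralBelief_le (S := solutionMap A B b c) hY.measurableSet
    (fun x => (hargmin x).2.2.measurableSet) (x := x) (x' := x')
    (D := C * ‖mulVecCLM A‖ * dist x x') fun f hf => by
      rw [image_solutionMap c hR, image_solutionMap c hR, mul_assoc]
      exact (h _ _ (hfeas x) (hfeas x') f hf).trans
        (mul_le_mul_of_nonneg_left (dist_boxedRhs_le A b R x.1 x'.1) hC)
  refine hW.trans (le_of_eq ?_)
  rw [ENNReal.ofReal_mul (by positivity), edist_dist, ENNReal.ofReal_eq_coe_nnreal (by positivity)]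
  rfl
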